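/- Let $M,T\in\mathbb N$, ${\bf Y}\in\mathbb{C}^{M\times T}$, $\lambda\ge 0$ and $\mu\in\mathbb{R}\setminus\{0\}$. For ${\bf Z}\in\mathbb{C}^{M\times T}$ put $$f({\bf Z})=\|[{\bf Z},\mu{\bf I}]\|_{*}+\lambda\,\|[{\bf Y}-{\bf Z},\mu{\bf 1}]\|_{2,1},$$ where $[\cdot,\cdot]$ is horizontal concatenation, ${\bf I}$ is the $M\times M$ identity matrix, ${\bf 1}$ is the all-ones column of length $M$, $\|\cdot\|_*$ is the nuclear norm (the sum of the singular values) and $\|{\bf V}\|_{2,1}=\sum_{i=1}^{M}\|{\bf V}_{i,:}\|_2$ is the sum of the Euclidean norms of the rows. Put also $${\bf P}({\bf Z})=({\bf Z}{\bf Z}^{\mathrm H}+\mu^2{\bf I})^{-1/2},\qquad {\bf Q}({\bf Z})=\operatorname{diag}\Big(\big(\|({\bf Y}-{\bf Z})_{i,:}\|_2^2+\mu^2\big)^{-1/2}\Big)_{i=1}^{M}.$$ Then $f$ is convex on $\mathbb{C}^{M\times T}$. Moreover, for an arbitrary ${\bf Z}_0\in\mathbb{C}^{M\times T}$, let $\{{\bf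 Z}_k\}_{k\ge 0}$ be the IRLS sequence $${\bf Z}_{k+1}=\lambda\,({\bf P}_k+\lambda{\bf Q}_k)^{-1}{\bf Q}_k{\bf Y},\qquad {\bf P}_k={\bf P}({\bf Z}_k),\quad {\bf Q}_k={\bf Q}({\bf Z}_k).$$ Then every limit point (cluster point) ${\bf Z}_\star$ of $\{{\bf Z}_k\}$ is a stationary point of the problem $\min_{\bf Z} f({\bf Z})$, that is, $${\bf P}({\bf Z}_\star){\bf Z}_\star+\lambda\,{\bf Q}({\bf Z}_\star)({\bf Z}_\star-{\bf Y})={\bf 0},$$ and $f$, as a function on the real vector space $\mathbb{C}^{M\times T}$, is Fréchet differentiable at ${\bf Z}_\star$ with derivative zero; and ${\bf Z}_\star$ is a global minimizer: $f({\bf Z}_\star)\le f({\bf Z})$ for all ${\bf Z}\in\mathbb{C}^{M\times T}$. -/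

import Mathlib

open Filter Topology Matrix

noncomputable section

namespace IRLS

variable {m n : Type*} [Fintype m] [DecidableEq m] [Fintype n] [DecidableEq n]

/-- The nuclear norm `‖A‖_*` of a complex matrix: the sum of its singular values, repeated
according to multiplicity (the singular values with index at least the number of columns are
zero by convention, so nothing is left out). -/
def nuclearNorm (A : Matrix m n ℂ) : ℝ :=
  ∑ i ∈ Finset.range (Fintype.card n), (Matrix.toEuclideanLin A).singularValues i

/-- The Euclidean norm `‖A_{i,:}‖₂` of the `i`-th row of `A`. -/
def rowNorm (A : Matrix m n ℂ) (i : m) : ℝ :=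
  ‖(WithLp.toLp 2 (A i) : EuclideanSpace ℂ n)‖

/-- The mixed norm `‖A‖_{2,1} = ∑ i, ‖A_{i,:}‖₂`. -/
def l21Norm (A : Matrix m n ℂ) : ℝ :=
  ∑ i, rowNorm A i

/-- The smoothed objective `f(Z) = ‖[Z, μ I]‖_* + lam * ‖[Y - Z, μ 𝟏]‖_{2,1}`, where `[·, ·]` is
horizontal concatenation and `𝟏` is the all-ones column. -/
def objective (Y : Matrix m n ℂ) (lam μ : ℝ) (Z : Matrix m n ℂ) : ℝ :=
  nuclearNorm (Matrix.fromCols Z ((μ : ℂ) • (1 : Matrix m m ℂ))) +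
    lam * l21Norm (Matrix.fromCols (Y - Z) ((μ : ℂ) • (Matrix.of fun (_ : m) (_ : Fin 1) => 1)))

/-- The weight `P(Z) = (Z Zᴴ + μ² I)^(-1/2)`, through the functional calculus of Hermitian
matrices. -/
def weightP (μ : ℝ) (Z : Matrix m n ℂ) : Matrix m m ℂ :=
  cfc (fun x : ℝ => x ^ (-(1 / 2) : ℝ)) (Z * Zᴴ + ((μ : ℂ) ^ 2) • (1 : Matrix m m ℂ))

/-- The diagonal weight `Q(Z)` with entries `1 / √(‖(Y - Z)_{i,:}‖₂² + μ²)`. -/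
def weightQ (Y : Matrix m n ℂ) (μ : ℝ) (Z : Matrix m n ℂ) : Matrix m m ℂ :=
  Matrix.diagonal fun i => ((1 / Real.sqrt (rowNorm (Y - Z) i ^ 2 + μ ^ 2) : ℝ) : ℂ)

/-- One iteration `Z ↦ lam (P(Z) + lam Q(Z))⁻¹ Q(Z) Y`. -/
def step (Y : Matrix m n ℂ) (lam μ : ℝ) (Z : Matrix m n ℂ) : Matrix m n ℂ :=
  (lam : ℂ) • ((weightP μ Z + (lam : ℂ) • weightQ Y μ Z)⁻¹ * weightQ Y μ Z * Y)

/-- The sequence `Z_{k+1} = lam (P_k + lam Q_k)⁻¹ Q_k Y` started at `Z₀`. -/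
def iterates (Y : Matrix m n ℂ) (lam μ : ℝ) (Z₀ : Matrix m n ℂ) : ℕ → Matrix m n ℂ
  | 0 => Z₀
  | k + 1 => step Y lam μ (iterates Y lam μ Z₀ k)

end IRLS

end

namespace IRLS

section
open scoped ComplexOrder MatrixOrder

variable {m n : Type*} [Fintype m] [DecidableEq m] [Fintype n]

/-- The functional calculus of a Hermitian matrix has trace `∑ i, f (λᵢ)`. -/
theorem trace_cfc [DecidableEq n] {A : Matrix n n ℂ} (hA : A.IsHermitian) (f : ℝ → ℝ) :
    (cfc f A).trace = ∑ i, (f (hA.eigenvalues i) : ℂ) := by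
  rw [hA.cfc_eq f, IsHermitian.cfc, Unitary.conjStarAlgAut_apply, trace_mul_comm, ← mul_assoc]
  simp [trace_diagonal]

/-- The nuclear norm is the trace of `√(Aᴴ A)`. -/
theorem nuclearNorm_eq_sum_sqrt_eigenvalues [DecidableEq n] (A : Matrix m n ℂ) :
    nuclearNorm A = ∑ i, √((isHermitian_conjTranspose_mul_self A).eigenvalues i) := by
  have key : ∀ i : Fin (Fintype.card n), (toEuclideanLin A).singularValues i =
      √((isHermitian_conjTranspose_mul_self A).eigenvalues₀ i) := by
    intro i
    rw [LinearMap.singularValues_fin _ (finrank_euclideanSpace (𝕜 := ℂ) (ι := n))]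
    have h : LinearMap.adjoint (toEuclideanLin A) ∘ₗ toEuclideanLin A =
        toEuclideanLin (Aᴴ * A) := by
      rw [← toEuclideanLin_conjTranspose_eq_adjoint]
      ext x i
      simp [toLpLin_apply, mulVec_mulVec]
    unfold IsHermitian.eigenvalues₀
    congr 2
  rw [nuclearNorm, Finset.sum_range, Finset.sum_congr rfl fun i _ => key i]
  exact (Equiv.sum_comp (Fintype.equivOfCardEq (Fintype.card_fin _)).symm _).symm

/-- If `B` is positive semidefinite with `B² = Aᴴ A`, then `‖A‖_* = tr B`. -/
theorem nuclearNorm_eq_trace [DecidableEq n] {A : Matrix m n ℂ} {B : Matrix n n ℂ}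
    (hB : B.PosSemidef)
    (h : B * B = Aᴴ * A) : nuclearNorm A = B.trace.re := by
  have hs : IsSelfAdjoint B := hB.isHermitian
  have hsqrt : cfc Real.sqrt (Aᴴ * A) = B := by
    have hpow : Aᴴ * A = cfc (fun x : ℝ => x ^ 2) B := by
      rw [← h, cfc_pow_id B 2, sq]
    rw [hpow, ← cfc_comp' Real.sqrt (fun x : ℝ => x ^ 2) B]
    conv_rhs => rw [← cfc_id ℝ B]
    refine cfc_congr fun x hx => ?_
    exact Real.sqrt_sq (spectrum_nonneg_of_nonneg hB.nonneg hx)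
  rw [nuclearNorm_eq_sum_sqrt_eigenvalues, ← hsqrt,
    trace_cfc (isHermitian_conjTranspose_mul_self A)]
  simp

/-- `P` is the inverse square root of `A Aᴴ`. -/
structure IsInvSqrtGram (P : Matrix m m ℂ) (A : Matrix m n ℂ) : Prop where
  posDef : P.PosDef
  mul_mul_gram : P * P * (A * Aᴴ) = 1

namespace IsInvSqrtGram

variable {P P₀ : Matrix m m ℂ} {A A₀ : Matrix m n ℂ}

theorem conjTranspose_eq (h : IsInvSqrtGram P A) : Pᴴ = P := h.posDef.isHermitian

theorem mul_gram_mul (h : IsInvSqrtGram P A) : P * (A * Aᴴ) * P = 1 := by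
  rw [mul_eq_one_comm, ← mul_assoc, h.mul_mul_gram]

theorem gram_mul_comm (h : IsInvSqrtGram P A) : A * Aᴴ * P = P * (A * Aᴴ) := by
  have h1 : P * (A * Aᴴ * P) = 1 := by rw [← mul_assoc]; exact h.mul_gram_mul
  have h2 : P * (P * (A * Aᴴ)) = 1 := by rw [← mul_assoc]; exact h.mul_mul_gram
  exact h.posDef.isUnit.mul_left_cancel (h1.trans h2.symm)

/-- `‖A‖_* = tr (P A Aᴴ)` when `P = (A Aᴴ)^(-1/2)`. -/
theorem nuclearNorm_eq [DecidableEq n] (h : IsInvSqrtGram P A) :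
    nuclearNorm A = (P * (A * Aᴴ)).trace.re := by
  have hB : (Aᴴ * P * A).PosSemidef := h.posDef.posSemidef.conjTranspose_mul_mul_same A
  rw [nuclearNorm_eq_trace hB, trace_mul_comm, ← Matrix.mul_assoc, trace_mul_comm]
  calc Aᴴ * P * A * (Aᴴ * P * A) = Aᴴ * (P * (A * Aᴴ) * P) * A := by simp only [Matrix.mul_assoc]
    _ = Aᴴ * A := by rw [h.mul_gram_mul, Matrix.mul_one]

end IsInvSqrtGram

theorem re_trace_nonneg {A : Matrix n n ℂ} (hA : A.PosSemidef) : 0 ≤ A.trace.re :=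
  (Complex.le_def.mp hA.trace_nonneg).1

theorem re_trace_conjTranspose (A : Matrix n n ℂ) : Aᴴ.trace.re = A.trace.re := by
  simp [trace_conjTranspose]

namespace IsInvSqrtGram

variable {P P₀ : Matrix m m ℂ} {A A₀ : Matrix m n ℂ}

/-- The linear minorant of the nuclear norm. -/
theorem re_trace_le_nuclearNorm [DecidableEq n] (h₀ : IsInvSqrtGram P₀ A₀) (h : IsInvSqrtGram P A) :
    (P₀ * (A₀ * Aᴴ)).trace.re ≤ nuclearNorm A := by
  set R := P * (A * Aᴴ) with hR
  have hRh : Rᴴ = R := by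
    rw [hR, conjTranspose_mul, conjTranspose_mul, conjTranspose_conjTranspose, h.conjTranspose_eq,
      h.gram_mul_comm]
  have hRP : R * P = 1 := h.mul_gram_mul
  have hPR : P * R = 1 := mul_eq_one_comm.mp hRP
  set B := P₀ * A₀ with hB
  have hBB : B * Bᴴ = 1 := by
    rw [hB, conjTranspose_mul, h₀.conjTranspose_eq, ← h₀.mul_gram_mul]
    simp only [Matrix.mul_assoc]
  have key := re_trace_nonneg (h.posDef.posSemidef.mul_mul_conjTranspose_same (A - R * B)ᴴ)
  rw [conjTranspose_conjTranspose, trace_mul_comm] at key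
  have expand : (A - R * B) * ((A - R * B)ᴴ * P) = A * Aᴴ * P - A * Bᴴ * (R * P)
      - R * (B * Aᴴ) * P + R * (B * Bᴴ) * (R * P) := by
    rw [conjTranspose_sub, conjTranspose_mul, hRh]
    simp only [Matrix.sub_mul, Matrix.mul_sub, Matrix.mul_assoc]
    abel
  have hsw : (A * Bᴴ).trace.re = (B * Aᴴ).trace.re := by
    rw [← re_trace_conjTranspose, conjTranspose_mul, conjTranspose_conjTranspose]
  have hcyc : (R * (B * Aᴴ) * P).trace = (B * Aᴴ).trace := by
    rw [trace_mul_comm, ← Matrix.mul_assoc, hPR, Matrix.one_mul]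
  rw [expand, hRP, hBB, h.gram_mul_comm, Matrix.mul_one, Matrix.mul_one, Matrix.mul_one, trace_add,
    trace_sub, trace_sub, hcyc, Complex.add_re, Complex.sub_re, Complex.sub_re, hsw] at key
  rw [h.nuclearNorm_eq, ← Matrix.mul_assoc P₀]
  linarith

/-- The quadratic majorant of the nuclear norm. -/
theorem nuclearNorm_le [DecidableEq n] (h₀ : IsInvSqrtGram P₀ A₀) (h : IsInvSqrtGram P A) :
    nuclearNorm A ≤ ((P₀ * (A * Aᴴ)).trace.re + nuclearNorm A₀) / 2 := by
  set R := P * (A * Aᴴ) with hR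
  have hRh : Rᴴ = R := by
    rw [hR, conjTranspose_mul, conjTranspose_mul, conjTranspose_conjTranspose, h.conjTranspose_eq,
      h.gram_mul_comm]
  have hRR : R * R = A * Aᴴ := by
    calc R * R = (P * (A * Aᴴ) * P) * (A * Aᴴ) := by simp only [hR, Matrix.mul_assoc]
      _ = A * Aᴴ := by rw [h.mul_gram_mul, Matrix.one_mul]
  set W := P₀ * (A₀ * A₀ᴴ) with hW
  have hWh : Wᴴ = W := by
    rw [hW, conjTranspose_mul, conjTranspose_mul, conjTranspose_conjTranspose, h₀.conjTranspose_eq,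
      h₀.gram_mul_comm]
  have hWP : W * P₀ = 1 := h₀.mul_gram_mul
  have hPW : P₀ * W = 1 := mul_eq_one_comm.mp hWP
  have key := re_trace_nonneg (h₀.posDef.posSemidef.conjTranspose_mul_mul_same (R - W))
  have expand : (R - W)ᴴ * P₀ * (R - W) = R * (P₀ * R) - R * (P₀ * W) - W * P₀ * R
      + W * P₀ * W := by
    rw [conjTranspose_sub, hRh, hWh]
    simp only [Matrix.sub_mul, Matrix.mul_sub, Matrix.mul_assoc]
    abel
  rw [expand, hPW, hWP, Matrix.mul_one, Matrix.one_mul, Matrix.one_mul, trace_add, trace_sub,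
    trace_sub, trace_mul_comm, Matrix.mul_assoc, hRR, Complex.add_re, Complex.sub_re,
    Complex.sub_re] at key
  rw [h.nuclearNorm_eq, h₀.nuclearNorm_eq]
  linarith

/-- First-order expansion of the nuclear norm, bounded below. -/
theorem nuclearNorm_add_le [DecidableEq n] (h₀ : IsInvSqrtGram P₀ A₀) (h : IsInvSqrtGram P A) :
    nuclearNorm A₀ + (P₀ * (A₀ * (A - A₀)ᴴ)).trace.re ≤ nuclearNorm A := by
  have := h₀.re_trace_le_nuclearNorm h
  rw [conjTranspose_sub, Matrix.mul_sub, Matrix.mul_sub, trace_sub, Complex.sub_re,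
    ← h₀.nuclearNorm_eq]
  linarith

/-- First-order expansion of the nuclear norm, bounded above with a quadratic remainder. -/
theorem nuclearNorm_le_add [DecidableEq n] (h₀ : IsInvSqrtGram P₀ A₀) (h : IsInvSqrtGram P A) :
    nuclearNorm A ≤ nuclearNorm A₀ + (P₀ * (A₀ * (A - A₀)ᴴ)).trace.re
      + (P₀ * ((A - A₀) * (A - A₀)ᴴ)).trace.re / 2 := by
  have hle := h₀.nuclearNorm_le h
  have hsw : (P₀ * (A * A₀ᴴ)).trace.re = (P₀ * (A₀ * Aᴴ)).trace.re := by
    rw [← re_trace_conjTranspose, conjTranspose_mul, conjTranspose_mul, conjTranspose_conjTranspose,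
      h₀.conjTranspose_eq, trace_mul_comm]
  have h1 : (P₀ * ((A - A₀) * (A - A₀)ᴴ)).trace.re = (P₀ * (A * Aᴴ)).trace.re
      - (P₀ * (A * A₀ᴴ)).trace.re - (P₀ * (A₀ * Aᴴ)).trace.re + (P₀ * (A₀ * A₀ᴴ)).trace.re := by
    simp only [conjTranspose_sub, Matrix.mul_sub, Matrix.sub_mul, trace_sub, Complex.sub_re]
    ring
  rw [h1, hsw, conjTranspose_sub, Matrix.mul_sub, Matrix.mul_sub, trace_sub, Complex.sub_re,
    ← h₀.nuclearNorm_eq]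
  linarith

end IsInvSqrtGram
end

section
open scoped ComplexOrder MatrixOrder

theorem fromCols_sub_fromCols {m n k : Type*} (A C : Matrix m n ℂ) (B : Matrix m k ℂ) :
    fromCols A B - fromCols C B = fromCols (A - C) 0 := by
  ext i (j | j) <;> simp

theorem isInvSqrtGram_cfc {m : Type*} [Fintype m] [DecidableEq m] {S : Matrix m m ℂ}
    (hS : S.PosDef) :
    (cfc (fun x : ℝ => x ^ (-(1 / 2) : ℝ)) S).PosDef ∧
      cfc (fun x : ℝ => x ^ (-(1 / 2) : ℝ)) S * cfc (fun x : ℝ => x ^ (-(1 / 2) : ℝ)) S * S = 1 := by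
  have hs : IsSelfAdjoint S := hS.isHermitian
  have hpos : ∀ x ∈ spectrum ℝ S, 0 < x := fun x hx =>
    hS.isStrictlyPositive.spectrum_pos hx
  have hc : ContinuousOn (fun x : ℝ => x ^ (-(1 / 2) : ℝ)) (spectrum ℝ S) := fun x hx =>
    (Real.continuousAt_rpow_const x _ (Or.inl (hpos x hx).ne')).continuousWithinAt
  have h1 : cfc (fun x : ℝ => x ^ (-(1 / 2) : ℝ)) S * cfc (fun x : ℝ => x ^ (-(1 / 2) : ℝ)) S * S
      = 1 := by
    nth_rw 3 [← cfc_id ℝ S]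
    rw [← cfc_mul _ _ S hc hc, ← cfc_mul (fun x : ℝ => x ^ (-(1 / 2) : ℝ) * x ^ (-(1 / 2) : ℝ)) id S
      (hc.mul hc) continuousOn_id, ← cfc_one ℝ S]
    refine cfc_congr fun x hx => ?_
    have := hpos x hx
    simp only [id, Pi.one_apply]
    rw [← Real.rpow_add this, show (-(1 / 2) + -(1 / 2) : ℝ) = -1 by norm_num, Real.rpow_neg_one,
      inv_mul_cancel₀ this.ne']
  refine ⟨?_, h1⟩
  rw [PosSemidef.posDef_iff_isUnit]
  · rw [mul_assoc] at h1
    exact IsUnit.of_mul_eq_one _ h1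
  · rw [← nonneg_iff_posSemidef]
    exact cfc_nonneg fun x hx => (Real.rpow_pos_of_pos (hpos x hx) _).le

theorem re_trace_diagonal_mul {m : Type*} [Fintype m] [DecidableEq m] (q : m → ℝ)
    (X : Matrix m m ℂ) :
    (diagonal (fun i => (q i : ℂ)) * X).trace.re = ∑ i, q i * (X i i).re := by
  simp [trace, diagonal_mul]

variable {m n k : Type*} [Fintype n]

theorem fromCols_mul_conjTranspose_fromCols [Fintype k] (A C : Matrix m n ℂ) (B D : Matrix m k ℂ) :
    fromCols A B * (fromCols C D)ᴴ = A * Cᴴ + B * Dᴴ := by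
  rw [conjTranspose_fromCols_eq_fromRows_conjTranspose, fromCols_mul_fromRows]

theorem posDef_regularizedGram [Fintype m] [DecidableEq m] {μ : ℝ} (hμ : μ ≠ 0) (Z : Matrix m n ℂ) :
    (Z * Zᴴ + ((μ : ℂ) ^ 2) • (1 : Matrix m m ℂ)).PosDef := by
  refine PosDef.posSemidef_add (posSemidef_self_mul_conjTranspose Z) (PosDef.one.smul ?_)
  rw [← Complex.ofReal_pow, Complex.zero_lt_real]
  positivity

theorem isInvSqrtGram_weightP [Fintype m] [DecidableEq m] {μ : ℝ} (hμ : μ ≠ 0) (Z : Matrix m n ℂ) :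
    IsInvSqrtGram (weightP μ Z) (fromCols Z ((μ : ℂ) • (1 : Matrix m m ℂ))) := by
  obtain ⟨h1, h2⟩ := isInvSqrtGram_cfc (posDef_regularizedGram hμ Z)
  refine ⟨h1, ?_⟩
  rw [fromCols_mul_conjTranspose_fromCols]
  have hμ2 : ((μ : ℂ) • (1 : Matrix m m ℂ)) * ((μ : ℂ) • (1 : Matrix m m ℂ))ᴴ =
      ((μ : ℂ) ^ 2) • (1 : Matrix m m ℂ) := by
    rw [conjTranspose_smul, conjTranspose_one, Matrix.smul_mul, Matrix.one_mul, smul_smul]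
    simp [sq]
  rw [hμ2]
  exact h2

open scoped Matrix.Norms.L2Operator in
theorem continuous_weightP [Fintype m] [DecidableEq m] {μ : ℝ} (hμ : μ ≠ 0) :
    Continuous (weightP μ : Matrix m n ℂ → Matrix m m ℂ) := by
  refine Continuous.cfc_of_mem_nhdsSet (s := Set.Ioi 0) (p := IsSelfAdjoint)
    (fun x : ℝ => x ^ (-(1 / 2) : ℝ)) ?_ ?_ ?_ ?_
  · rw [isOpen_Ioi.mem_nhdsSet, Set.iUnion_subset_iff]
    exact fun Z x hx => (posDef_regularizedGram hμ Z).isStrictlyPositive.spectrum_pos hx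
  · fun_prop
  · exact fun Z => (posDef_regularizedGram hμ Z).isHermitian
  · exact fun x hx => (Real.continuousAt_rpow_const x _ (Or.inl (ne_of_gt hx))).continuousWithinAt

theorem rowNorm_sq (A : Matrix m n ℂ) (i : m) : rowNorm A i ^ 2 = ∑ j, ‖A i j‖ ^ 2 := by
  rw [rowNorm, EuclideanSpace.norm_sq_eq]

theorem continuous_rowNorm (i : m) : Continuous fun A : Matrix m n ℂ => rowNorm A i := by
  unfold rowNorm
  fun_prop

/-- The inner product of two rows. -/
theorem inner_row (A B : Matrix m n ℂ) (i : m) :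
    inner ℂ (WithLp.toLp 2 (B i) : EuclideanSpace ℂ n) (WithLp.toLp 2 (A i)) = (A * Bᴴ) i i := by
  rw [EuclideanSpace.inner_toLp_toLp]
  rfl

theorem re_mul_conjTranspose_self (A : Matrix m n ℂ) (i : m) :
    ((A * Aᴴ) i i).re = rowNorm A i ^ 2 := by
  rw [← inner_row, rowNorm]
  exact inner_self_eq_norm_sq (𝕜 := ℂ) _

theorem re_mul_conjTranspose_le (A B : Matrix m n ℂ) (i : m) :
    ((A * Bᴴ) i i).re ≤ rowNorm A i * rowNorm B i := by
  rw [← inner_row, mul_comm]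
  exact re_inner_le_norm (𝕜 := ℂ) _ _

variable {A A₀ : Matrix m n ℂ}

theorem re_mul_conjTranspose_sub (A A₀ : Matrix m n ℂ) (i : m) :
    ((A₀ * (A - A₀)ᴴ) i i).re = ((A₀ * Aᴴ) i i).re - rowNorm A₀ i ^ 2 := by
  rw [conjTranspose_sub, Matrix.mul_sub, Matrix.sub_apply, Complex.sub_re,
    re_mul_conjTranspose_self]

theorem rowNorm_sub_sq (A A₀ : Matrix m n ℂ) (i : m) :
    rowNorm (A - A₀) i ^ 2 = rowNorm A i ^ 2 - 2 * ((A₀ * Aᴴ) i i).re + rowNorm A₀ i ^ 2 := by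
  have hsw : ((A * A₀ᴴ) i i).re = ((A₀ * Aᴴ) i i).re := by
    rw [show A * A₀ᴴ = (A₀ * Aᴴ)ᴴ by simp, conjTranspose_apply]
    simp
  simp only [← re_mul_conjTranspose_self, conjTranspose_sub, Matrix.mul_sub, Matrix.sub_mul,
    Matrix.sub_apply, Complex.sub_re, hsw]
  ring

/-- First-order expansion of the mixed norm, bounded below. -/
theorem l21Norm_add_le [Fintype m] [DecidableEq m] (h₀ : ∀ i, 0 < rowNorm A₀ i) :
    l21Norm A₀ + (diagonal (fun i => ((1 / rowNorm A₀ i : ℝ) : ℂ)) *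
      (A₀ * (A - A₀)ᴴ)).trace.re ≤ l21Norm A := by
  rw [re_trace_diagonal_mul, l21Norm, l21Norm, ← Finset.sum_add_distrib]
  refine Finset.sum_le_sum fun i _ => ?_
  have h := h₀ i
  have h1 := re_mul_conjTranspose_le A₀ A i
  rw [re_mul_conjTranspose_sub, one_div, inv_mul_eq_div, ← le_sub_iff_add_le', div_le_iff₀ h]
  linarith

/-- First-order expansion of the mixed norm, bounded above with a quadratic remainder. -/
theorem l21Norm_le_add [Fintype m] [DecidableEq m] (h₀ : ∀ i, 0 < rowNorm A₀ i) :
    l21Norm A ≤ l21Norm A₀ + (diagonal (fun i => ((1 / rowNorm A₀ i : ℝ) : ℂ)) *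
      (A₀ * (A - A₀)ᴴ)).trace.re + (diagonal (fun i => ((1 / rowNorm A₀ i : ℝ) : ℂ)) *
      ((A - A₀) * (A - A₀)ᴴ)).trace.re / 2 := by
  simp only [re_trace_diagonal_mul, l21Norm]
  rw [Finset.sum_div, ← Finset.sum_add_distrib, ← Finset.sum_add_distrib]
  refine Finset.sum_le_sum fun i _ => ?_
  have h := h₀ i
  rw [re_mul_conjTranspose_self, re_mul_conjTranspose_sub, rowNorm_sub_sq]
  have : rowNorm A₀ i + 1 / rowNorm A₀ i * (((A₀ * Aᴴ) i i).re - rowNorm A₀ i ^ 2) +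
      1 / rowNorm A₀ i * (rowNorm A i ^ 2 - 2 * ((A₀ * Aᴴ) i i).re + rowNorm A₀ i ^ 2) / 2
      = (rowNorm A i ^ 2 + rowNorm A₀ i ^ 2) / (2 * rowNorm A₀ i) := by
    field_simp
    ring
  rw [this, le_div_iff₀ (by positivity)]
  nlinarith [sq_nonneg (rowNorm A i - rowNorm A₀ i)]

theorem rowNorm_fromCols_const (V : Matrix m n ℂ) (μ : ℝ) (i : m) :
    rowNorm (fromCols V ((μ : ℂ) • (Matrix.of fun (_ : m) (_ : Fin 1) => 1))) i =
      √(rowNorm V i ^ 2 + μ ^ 2) := by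
  have h : 0 ≤ rowNorm (fromCols V ((μ : ℂ) • (Matrix.of fun (_ : m) (_ : Fin 1) => 1))) i :=
    norm_nonneg _
  rw [← Real.sqrt_sq h, rowNorm_sq, rowNorm_sq]
  simp

end

section
open scoped ComplexOrder MatrixOrder

theorem weightQ_eq_diagonal_rowNorm {m n : Type*} [DecidableEq m] [Fintype n] (Y : Matrix m n ℂ)
    (μ : ℝ) (Z : Matrix m n ℂ) :
    weightQ Y μ Z = diagonal fun i => ((1 / rowNorm (fromCols (Y - Z)
      ((μ : ℂ) • (Matrix.of fun (_ : m) (_ : Fin 1) => 1))) i : ℝ) : ℂ) := by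
  simp only [rowNorm_fromCols_const, weightQ]

theorem rowNorm_fromCols_const_pos {m n : Type*} [Fintype n] {μ : ℝ} (hμ : μ ≠ 0)
    (V : Matrix m n ℂ) (i : m) :
    0 < rowNorm (fromCols V ((μ : ℂ) • (Matrix.of fun (_ : m) (_ : Fin 1) => 1))) i := by
  rw [rowNorm_fromCols_const]
  positivity

theorem posDef_weightQ {m n : Type*} [DecidableEq m] [Fintype n] (Y : Matrix m n ℂ) {μ : ℝ}
    (hμ : μ ≠ 0) (Z : Matrix m n ℂ) :
    (weightQ Y μ Z).PosDef := by
  refine PosDef.diagonal fun i => ?_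
  rw [Complex.zero_lt_real]
  positivity

theorem continuous_weightQ {m n : Type*} [DecidableEq m] [Fintype n] (Y : Matrix m n ℂ) {μ : ℝ}
    (hμ : μ ≠ 0) :
    Continuous (weightQ Y μ) := by
  refine Continuous.matrix_diagonal (continuous_pi fun i => Complex.continuous_ofReal.comp ?_)
  refine continuous_const.div ?_ fun Z => by positivity
  have := (continuous_rowNorm (n := n) i).comp
    (continuous_const.sub continuous_id : Continuous fun Z => Y - Z)
  exact (((this.pow 2).add continuous_const)).sqrt

variable {m n : Type*} [Fintype m] [DecidableEq m] [Fintype n]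

/-- The Hessian `P(Z) + lam Q(Z)` of the quadratic majorant at `Z`. -/
noncomputable def majorantHessian (Y : Matrix m n ℂ) (lam μ : ℝ) (Z : Matrix m n ℂ) :
    Matrix m m ℂ :=
  weightP μ Z + (lam : ℂ) • weightQ Y μ Z

/-- The gradient `P(Z) Z + lam Q(Z) (Z - Y)` of the objective. -/
noncomputable def gradient (Y : Matrix m n ℂ) (lam μ : ℝ) (Z : Matrix m n ℂ) : Matrix m n ℂ :=
  weightP μ Z * Z + (lam : ℂ) • (weightQ Y μ Z * (Z - Y))

theorem objective_nonneg [DecidableEq n] (Y : Matrix m n ℂ) {lam : ℝ} (hlam : 0 ≤ lam) (μ : ℝ)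
    (Z : Matrix m n ℂ) : 0 ≤ objective Y lam μ Z := by
  refine add_nonneg (Finset.sum_nonneg fun i _ => LinearMap.singularValues_nonneg _ _)
    (mul_nonneg hlam (Finset.sum_nonneg fun i _ => norm_nonneg _))

section
variable (Y : Matrix m n ℂ) {lam μ : ℝ} (hlam : 0 ≤ lam) (hμ : μ ≠ 0)
include hlam hμ

theorem posDef_majorantHessian (Z : Matrix m n ℂ) : (majorantHessian Y lam μ Z).PosDef := by
  refine (isInvSqrtGram_weightP hμ Z).posDef.add_posSemidef
    ((posDef_weightQ Y hμ Z).posSemidef.smul ?_)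
  rw [Complex.zero_le_real]
  exact hlam

theorem continuous_step : Continuous (step Y lam μ) := by
  have hH : Continuous (majorantHessian Y lam μ) :=
    (continuous_weightP hμ).add (Continuous.fun_const_smul (continuous_weightQ Y hμ) (lam : ℂ))
  have hinv : Continuous fun Z => (majorantHessian Y lam μ Z)⁻¹ := by
    rw [continuous_iff_continuousAt]
    intro Z
    refine ContinuousAt.comp (f := majorantHessian Y lam μ) (g := fun A => A⁻¹) ?_ hH.continuousAt
    refine continuousAt_matrix_inv _ ?_
    have hdet := (isUnit_iff_isUnit_det _).mp (posDef_majorantHessian Y hlam hμ Z).isUnit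
    exact NormedRing.inverse_continuousAt hdet.unit
  exact Continuous.fun_const_smul
    ((hinv.matrix_mul (continuous_weightQ Y hμ)).matrix_mul continuous_const) (lam : ℂ)

theorem majorantHessian_mul_step_sub (Z : Matrix m n ℂ) :
    majorantHessian Y lam μ Z * (step Y lam μ Z - Z) = -gradient Y lam μ Z := by
  have hdet := (isUnit_iff_isUnit_det _).mp (posDef_majorantHessian Y hlam hμ Z).isUnit
  have h1 : majorantHessian Y lam μ Z * step Y lam μ Z = (lam : ℂ) • (weightQ Y μ Z * Y) := by
    rw [step, Matrix.mul_smul, Matrix.mul_assoc, ← majorantHessian,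
      mul_nonsing_inv_cancel_left _ _ hdet]
  rw [Matrix.mul_sub, h1, majorantHessian, gradient, Matrix.add_mul, Matrix.mul_sub,
    Matrix.smul_mul, smul_sub]
  abel

variable [DecidableEq n]

theorem objective_add_le (Z₀ Z : Matrix m n ℂ) :
    objective Y lam μ Z₀ + (gradient Y lam μ Z₀ * (Z - Z₀)ᴴ).trace.re ≤ objective Y lam μ Z := by
  have h1 := (isInvSqrtGram_weightP hμ Z₀).nuclearNorm_add_le (isInvSqrtGram_weightP hμ Z)
  have h2 := mul_le_mul_of_nonneg_left (l21Norm_add_le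
    (A := fromCols (Y - Z) ((μ : ℂ) • (Matrix.of fun (_ : m) (_ : Fin 1) => 1)))
    (rowNorm_fromCols_const_pos hμ (Y - Z₀))) hlam
  rw [← weightQ_eq_diagonal_rowNorm] at h2
  simp only [fromCols_sub_fromCols, fromCols_mul_conjTranspose_fromCols, conjTranspose_zero,
    Matrix.mul_zero, add_zero, sub_sub_sub_cancel_left] at h1 h2
  have h3 : (Y - Z₀) * (Z₀ - Z)ᴴ = (Z₀ - Y) * (Z - Z₀)ᴴ := by
    rw [← neg_sub Z₀ Y, ← neg_sub Z Z₀, conjTranspose_neg, Matrix.neg_mul, Matrix.mul_neg, neg_neg]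
  rw [h3] at h2
  simp only [objective, gradient, Matrix.add_mul, Matrix.smul_mul, Matrix.mul_assoc, trace_add,
    trace_smul, smul_eq_mul, Complex.add_re, Complex.re_ofReal_mul]
  linarith

theorem objective_le_add (Z₀ Z : Matrix m n ℂ) :
    objective Y lam μ Z ≤ objective Y lam μ Z₀ + (gradient Y lam μ Z₀ * (Z - Z₀)ᴴ).trace.re
      + (majorantHessian Y lam μ Z₀ * ((Z - Z₀) * (Z - Z₀)ᴴ)).trace.re / 2 := by
  have h1 := (isInvSqrtGram_weightP hμ Z₀).nuclearNorm_le_add (isInvSqrtGram_weightP hμ Z)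
  have h2 := mul_le_mul_of_nonneg_left (l21Norm_le_add
    (A := fromCols (Y - Z) ((μ : ℂ) • (Matrix.of fun (_ : m) (_ : Fin 1) => 1)))
    (rowNorm_fromCols_const_pos hμ (Y - Z₀))) hlam
  rw [← weightQ_eq_diagonal_rowNorm] at h2
  simp only [fromCols_sub_fromCols, fromCols_mul_conjTranspose_fromCols, conjTranspose_zero,
    Matrix.mul_zero, add_zero, sub_sub_sub_cancel_left] at h1 h2
  have h3 : (Y - Z₀) * (Z₀ - Z)ᴴ = (Z₀ - Y) * (Z - Z₀)ᴴ := by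
    rw [← neg_sub Z₀ Y, ← neg_sub Z Z₀, conjTranspose_neg, Matrix.neg_mul, Matrix.mul_neg, neg_neg]
  have h4 : (Z₀ - Z) * (Z₀ - Z)ᴴ = (Z - Z₀) * (Z - Z₀)ᴴ := by
    rw [← neg_sub Z Z₀, conjTranspose_neg, Matrix.neg_mul, Matrix.mul_neg, neg_neg]
  rw [h3, h4] at h2
  simp only [objective, gradient, majorantHessian, Matrix.add_mul, Matrix.smul_mul,
    Matrix.mul_assoc, trace_add, trace_smul, smul_eq_mul, Complex.add_re, Complex.re_ofReal_mul]
  linarith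

theorem convexOn_objective : ConvexOn ℝ Set.univ (objective Y lam μ) := by
  refine ⟨convex_univ, fun Z₁ _ Z₂ _ a b ha hb hab => ?_⟩
  set Z := a • Z₁ + b • Z₂ with hZ
  have h1 := mul_le_mul_of_nonneg_left (objective_add_le Y hlam hμ Z Z₁) ha
  have h2 := mul_le_mul_of_nonneg_left (objective_add_le Y hlam hμ Z Z₂) hb
  have h3 : a * (gradient Y lam μ Z * (Z₁ - Z)ᴴ).trace.re
      + b * (gradient Y lam μ Z * (Z₂ - Z)ᴴ).trace.re = 0 := by
    have h0 : a • (Z₁ - Z) + b • (Z₂ - Z) = 0 := by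
      rw [smul_sub, smul_sub, sub_add_sub_comm, ← add_smul, hab, one_smul, ← hZ, sub_self]
    have := congrArg (fun X => (gradient Y lam μ Z * Xᴴ).trace.re) h0
    simpa [conjTranspose_add, conjTranspose_smul, Matrix.mul_add, trace_add, trace_smul] using this
  simp only [smul_eq_mul]
  have h4 : objective Y lam μ Z = a * objective Y lam μ Z + b * objective Y lam μ Z := by
    rw [← add_mul, hab, one_mul]
  linarith

theorem continuous_objective : Continuous (objective Y lam μ) := by
  rw [continuous_iff_continuousAt]
  intro Z₀
  have hlow : Continuous fun Z : Matrix m n ℂ =>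
      objective Y lam μ Z₀ + (gradient Y lam μ Z₀ * (Z - Z₀)ᴴ).trace.re := by fun_prop
  have hup : Continuous fun Z : Matrix m n ℂ =>
      objective Y lam μ Z₀ + (gradient Y lam μ Z₀ * (Z - Z₀)ᴴ).trace.re
      + (majorantHessian Y lam μ Z₀ * ((Z - Z₀) * (Z - Z₀)ᴴ)).trace.re / 2 := by fun_prop
  refine tendsto_of_tendsto_of_tendsto_of_le_of_le ?_ ?_ (objective_add_le Y hlam hμ Z₀)
    (objective_le_add Y hlam hμ Z₀)
  · simpa using hlow.tendsto Z₀
  · simpa using hup.tendsto Z₀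

theorem objective_step_le (Z : Matrix m n ℂ) :
    objective Y lam μ (step Y lam μ Z) + ((step Y lam μ Z - Z)ᴴ * majorantHessian Y lam μ Z *
      (step Y lam μ Z - Z)).trace.re / 2 ≤ objective Y lam μ Z := by
  have h := objective_le_add Y hlam hμ Z (step Y lam μ Z)
  rw [← neg_neg (gradient Y lam μ Z), ← majorantHessian_mul_step_sub Y hlam hμ, ← Matrix.mul_assoc,
    Matrix.neg_mul, trace_neg, Complex.neg_re, trace_mul_comm, ← Matrix.mul_assoc] at h
  linarith

theorem antitone_objective_iterates (Z₀ : Matrix m n ℂ) :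
    Antitone fun k => objective Y lam μ (iterates Y lam μ Z₀ k) := by
  refine antitone_nat_of_succ_le fun k => ?_
  have h1 := objective_step_le Y hlam hμ (iterates Y lam μ Z₀ k)
  have h2 := re_trace_nonneg ((posDef_majorantHessian Y hlam hμ
    (iterates Y lam μ Z₀ k)).posSemidef.conjTranspose_mul_mul_same
      (step Y lam μ (iterates Y lam μ Z₀ k) - iterates Y lam μ Z₀ k))
  rw [iterates]
  linarith

/-- A point at which the iteration does not decrease the objective is stationary. -/
theorem gradient_eq_zero_of_le_objective_step {Z : Matrix m n ℂ}
    (h : objective Y lam μ Z ≤ objective Y lam μ (step Y lam μ Z)) : gradient Y lam μ Z = 0 := by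
  have h1 := objective_step_le Y hlam hμ Z
  have hH := posDef_majorantHessian Y hlam hμ Z
  have hpsd := hH.posSemidef.conjTranspose_mul_mul_same (step Y lam μ Z - Z)
  have htr : ((step Y lam μ Z - Z)ᴴ * majorantHessian Y lam μ Z *
      (step Y lam μ Z - Z)).trace = 0 := by
    have h2 := Complex.le_def.mp hpsd.trace_nonneg
    exact Complex.ext (le_antisymm (by simp only [Complex.zero_re]; linarith) h2.1) h2.2.symm
  have h0 := hpsd.trace_eq_zero_iff.mp htr
  obtain ⟨B, hB⟩ := CStarAlgebra.nonneg_iff_eq_star_mul_self.mp hH.posSemidef.nonneg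
  have hBD : B * (step Y lam μ Z - Z) = 0 := by
    rw [← conjTranspose_mul_self_eq_zero, ← h0, hB, conjTranspose_mul, star_eq_conjTranspose]
    simp only [Matrix.mul_assoc]
  rw [← neg_eq_zero, ← majorantHessian_mul_step_sub Y hlam hμ, hB, Matrix.mul_assoc, hBD,
    Matrix.mul_zero]

theorem gradient_eq_zero_of_mapClusterPt {Z₀ Z : Matrix m n ℂ}
    (hZ : MapClusterPt Z atTop (iterates Y lam μ Z₀)) : gradient Y lam μ Z = 0 := by
  refine gradient_eq_zero_of_le_objective_step Y hlam hμ (le_of_eq ?_)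
  have hf := continuous_objective Y hlam hμ
  have hlim := tendsto_atTop_ciInf (antitone_objective_iterates Y hlam hμ Z₀)
    ⟨0, by rintro _ ⟨k, rfl⟩; exact objective_nonneg Y hlam μ _⟩
  have heq : ∀ {x ℓ : ℝ} {u : ℕ → ℝ}, MapClusterPt x atTop u → Tendsto u atTop (𝓝 ℓ) → x = ℓ :=
    fun hx hu => eq_of_nhds_neBot (hx.clusterPt.mono hu)
  have h1 := heq (hZ.continuousAt_comp hf.continuousAt) hlim
  have h2 := heq (hZ.continuousAt_comp (hf.comp (continuous_step Y hlam hμ)).continuousAt)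
    ((tendsto_add_atTop_iff_nat 1).mpr hlim)
  exact h1.trans h2.symm

theorem objective_le_of_gradient_eq_zero {Z₀ : Matrix m n ℂ} (h : gradient Y lam μ Z₀ = 0)
    (Z : Matrix m n ℂ) : objective Y lam μ Z₀ ≤ objective Y lam μ Z := by
  simpa [h] using objective_add_le Y hlam hμ Z₀ Z

open scoped Matrix.Norms.Elementwise in
theorem hasFDerivAt_objective_zero {Z₀ : Matrix m n ℂ} (h : gradient Y lam μ Z₀ = 0) :
    HasFDerivAt (𝕜 := ℝ) (objective Y lam μ) 0 Z₀ := by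
  refine HasFDerivAt.of_isLittleO ?_
  have hentry : ∀ i j, (fun Z : Matrix m n ℂ => (Z - Z₀) i j) =O[𝓝 Z₀] fun Z => ‖Z - Z₀‖ :=
    fun i j => Asymptotics.IsBigO.of_bound' (Eventually.of_forall fun Z => by
      rw [norm_norm]
      exact Matrix.norm_entry_le_entrywise_sup_norm _)
  have hgram : ∀ i j, (fun Z : Matrix m n ℂ => ((Z - Z₀) * (Z - Z₀)ᴴ) i j) =O[𝓝 Z₀]
      fun Z => ‖Z - Z₀‖ ^ 2 := by
    intro i j
    simp only [Matrix.mul_apply, conjTranspose_apply, sq]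
    exact Asymptotics.IsBigO.fun_sum fun k _ => (hentry i k).mul (.trans
      (Asymptotics.IsBigO.of_bound' (Eventually.of_forall fun Z => (norm_star _).le)) (hentry j k))
  have htrace : (fun Z : Matrix m n ℂ => (majorantHessian Y lam μ Z₀ *
      ((Z - Z₀) * (Z - Z₀)ᴴ)).trace) =O[𝓝 Z₀] fun Z => ‖Z - Z₀‖ ^ 2 := by
    simp only [trace, diag, Matrix.mul_apply (M := majorantHessian Y lam μ Z₀)]
    exact Asymptotics.IsBigO.fun_sum fun i _ => Asymptotics.IsBigO.fun_sum fun j _ =>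
      (hgram j i).const_mul_left _
  have hO : (fun Z : Matrix m n ℂ => objective Y lam μ Z - objective Y lam μ Z₀) =O[𝓝 Z₀]
      fun Z => ‖Z - Z₀‖ ^ 2 := by
    refine .trans (Asymptotics.IsBigO.of_bound' (Eventually.of_forall fun Z => ?_)) htrace
    have h1 := objective_le_of_gradient_eq_zero Y hlam hμ h Z
    have h2 := objective_le_add Y hlam hμ Z₀ Z
    have h3 := Complex.re_le_norm (majorantHessian Y lam μ Z₀ * ((Z - Z₀) * (Z - Z₀)ᴴ)).trace
    have h4 := norm_nonneg (majorantHessian Y lam μ Z₀ * ((Z - Z₀) * (Z - Z₀)ᴴ)).trace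
    rw [h, Matrix.zero_mul, trace_zero, Complex.zero_re] at h2
    rw [Real.norm_of_nonneg (sub_nonneg.mpr h1)]
    linarith
  refine Asymptotics.IsLittleO.congr_left (hO.trans_isLittleO ?_) fun Z => (sub_zero _).symm
  rw [← Asymptotics.isLittleO_norm_right]
  have h0 : (fun Z : Matrix m n ℂ => ‖Z - Z₀‖) =o[𝓝 Z₀] fun _ => (1 : ℝ) := by
    rw [Asymptotics.isLittleO_one_iff]
    simpa using ((continuous_id (X := Matrix m n ℂ)).tendsto Z₀ |>.sub_const Z₀).norm
  simpa [sq] using h0.mul_isBigO (Asymptotics.isBigO_refl (fun Z : Matrix m n ℂ => ‖Z - Z₀‖) _)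

end
end
end IRLS

theorem mainTheorem3 (M T : ℕ) (Y : Matrix (Fin M) (Fin T) ℂ) (lam μ : ℝ)
    (hlam : 0 ≤ lam) (hμ : μ ≠ 0) :
    ConvexOn ℝ Set.univ (IRLS.objective Y lam μ) ∧
    ∀ Z₀ Zlim : Matrix (Fin M) (Fin T) ℂ,
      MapClusterPt Zlim atTop (IRLS.iterates Y lam μ Z₀) →
        IRLS.weightP μ Zlim * Zlim + (lam : ℂ) • (IRLS.weightQ Y μ Zlim * (Zlim - Y)) = 0 ∧
        HasFDerivAt (𝕜 := ℝ) (IRLS.objective Y lam μ) 0 Zlim ∧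
        ∀ Z : Matrix (Fin M) (Fin T) ℂ,
          IRLS.objective Y lam μ Zlim ≤ IRLS.objective Y lam μ Z := by
  refine ⟨IRLS.convexOn_objective Y hlam hμ, fun Z₀ Zlim hZ => ?_⟩
  have hgrad := IRLS.gradient_eq_zero_of_mapClusterPt Y hlam hμ hZ
  exact ⟨hgrad, IRLS.hasFDerivAt_objective_zero Y hlam hμ hgrad,
    IRLS.objective_le_of_gradient_eq_zero Y hlam hμ hgrad⟩
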